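/- Let $n$ discrete-time linear control systems $\Sigma_j$: $x^{(j)}_{k+1}=A_jx^{(j)}_k+B_ju^{(j)}_k$, $j=1,\dots,n$, be given, with state spaces $X_j=\mathbb R^{d_j}$ and nonempty control value sets $U_j\subset\mathbb R^{m_j}$, and let $\Sigma$ be their direct product, with state space $X=X_1\times\cdots\times X_n$, control value set $U=U_1\times\cdots\times U_n$, and right-hand side $f(x,u)=(A_1x_1+B_1u_1,\dots,A_nx_n+B_nu_n)$. For $x\in X$ and $\omega\in U^{\mathbb Z_+}$ let $\varphi(k,x,\omega)$ be the state at time $k$ of the trajectory of $\Sigma$ starting in $x$ with control sequence $\omega$. Let $Q\subset X$ be compact with nonempty interior and such that for every $x\in Q$ there is $u\in U$ with $f(x,u)\in\operatorname{int}Q$. For an integer $\tau>0$, a set $\mathcal S\subset U^{\mathbb Z_+}$ is called $(\tau,Q)$-spanning if for every $x\in Q$ there is $\omega\in\mathcal S$ with $\varphi(k,x,\omega)\in\operatorname{int}Q$ for $k=1,\dots,\tau$; a set $\mathcal S_i\subset U_i^{\mathbb Z_+}$ is called $(\tau,Q)^{(i)}$-spanning if the set of all $\omega\in U^{\mathbb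 Z_+}$ whose $i$-th component lies in $\mathcal S_i$ is $(\tau,Q)$-spanning. Let $r_{\rm inv}(\tau,Q)$ and $r^{(i)}_{\rm inv}(\tau,Q)$ be the minimal cardinalities of such sets, and put $$h_{\rm inv}(Q)=\lim_{\tau\to\infty}\frac1\tau\log_2 r_{\rm inv}(\tau,Q),\qquad h^{(i)}_{\rm inv}(Q)=\lim_{\tau\to\infty}\frac1\tau\log_2 r^{(i)}_{\rm inv}(\tau,Q).$$ Assume that there is a compact set $K\subset\operatorname{int}Q$ such that for every $x\in Q$ there is $u\in U$ with $f(x,u)\in\operatorname{int}K$. Fix $i\in\{1,\dots,n\}$ and assume that for each $j\neq i$ the pair $(A_j,B_j)$ is controllable (the matrix $[B_j,A_jB_j,\dots,A_j^{d_j-1}B_j]$ has rank $d_j$) and $U_j\subset\overline{\operatorname{int}U_j}$ (for example, $U_j=\mathbb R^{m_j}$, or $U_j$ convex with nonempty interior). Then the numbers $r^{(i)}_{\rm inv}(\tau,Q)$, $\tau>0$, are finite, the limit defining $h^{(i)}_{\rm inv}(Q)$ exists, and $$h^{(i)}_{\rm inv}(Q)=\sum_{\lambda\in\sigma(A_i)}\max\{0,\,n_\lambda\log_2|\lambda|\},$$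 where $\sigma(A_i)\subset\mathbb C$ is the set of distinct complex eigenvalues of $A_i$, $n_\lambda$ is the algebraic multiplicity of $\lambda$, and an eigenvalue $\lambda=0$ contributes $0$. In particular, if all pairs $(A_j,B_j)$ are controllable and, in case $n\ge2$, $U_j\subset\overline{\operatorname{int}U_j}$ for all $j$, then the numbers $r_{\rm inv}(\tau,Q)$ are finite, the limit defining $h_{\rm inv}(Q)$ exists, and $$\sum_{i=1}^n h^{(i)}_{\rm inv}(Q)=h_{\rm inv}(Q).$$ -/

import Mathlib

open Filter Topology

namespace NetEntropy

noncomputable section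

/-! ### Control systems and invariance entropy

A discrete-time control system is given by its right-hand side `f : X → U → X`;
the admissible control sequences are all functions `ℕ → U`. -/

/-- The transition map: `transition f k x ω = (f_{ω (k-1)} ∘ ⋯ ∘ f_{ω 0}) x`. -/
def transition {X U : Type*} (f : X → U → X) : ℕ → X → (ℕ → U) → X
  | 0, x, _ => x
  | k + 1, x, ω => f (transition f k x ω) (ω k)

/-- `Q` is (strongly) controlled invariant: a compact set with nonempty interior such that
every point of `Q` can be steered into the interior of `Q` in one step. -/
structure IsControlledInvariant {X U : Type*} [TopologicalSpace X] (f : X → U → X)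
    (Q : Set X) : Prop where
  isCompact : IsCompact Q
  interior_nonempty : (interior Q).Nonempty
  steer : ∀ x ∈ Q, ∃ u : U, f x u ∈ interior Q

/-- `S` is `(τ, Q)`-spanning. -/
def IsSpanning {X U : Type*} [TopologicalSpace X] (f : X → U → X) (τ : ℕ) (Q : Set X)
    (S : Set (ℕ → U)) : Prop :=
  ∀ x ∈ Q, ∃ ω ∈ S, ∀ k : ℕ, 1 ≤ k → k ≤ τ → transition f k x ω ∈ interior Q

/-- The minimal cardinality of a `(τ, Q)`-spanning set (`⊤` if there is no finite one). -/
def rInv {X U : Type*} [TopologicalSpace X] (f : X → U → X) (τ : ℕ) (Q : Set X) : ℕ∞ :=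
  ⨅ (S : Set (ℕ → U)) (_ : IsSpanning f τ Q S), S.encard

/-- The numbers `(1/τ) log₂ r_inv(τ, Q)`. -/
def entropySeq {X U : Type*} [TopologicalSpace X] (f : X → U → X) (Q : Set X) (τ : ℕ) : ℝ :=
  1 / (τ : ℝ) * Real.logb 2 ((rInv f τ Q).toNat : ℝ)

/-- The invariance entropy `h_inv(Q)`, the limit of `entropySeq f Q`. -/
def hInv {X U : Type*} [TopologicalSpace X] (f : X → U → X) (Q : Set X) : ℝ :=
  limUnder atTop (entropySeq f Q)

/-! ### Networks of subsystems -/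

/-- The overall system: the direct product of the subsystems `f j`. -/
def prodSystem {ι : Type*} {X U : ι → Type*} (f : ∀ j, X j → U j → X j) :
    (∀ j, X j) → (∀ j, U j) → ∀ j, X j :=
  fun x u j => f j (x j) (u j)

/-- A set `S` of control sequences of the `i`-th subsystem is `(τ, Q)^{(i)}`-spanning if the set
of all control sequences of the overall system whose `i`-th component is in `S` is
`(τ, Q)`-spanning for the overall system. -/
def IsSubSpanning {ι : Type*} {X U : ι → Type*} [∀ j, TopologicalSpace (X j)]
    (f : ∀ j, X j → U j → X j) (i : ι) (τ : ℕ) (Q : Set (∀ j, X j))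
    (S : Set (ℕ → U i)) : Prop :=
  IsSpanning (prodSystem f) τ Q {ω : ℕ → ∀ j, U j | (fun k => ω k i) ∈ S}

/-- The minimal cardinality of a `(τ, Q)^{(i)}`-spanning set (`⊤` if there is no finite one). -/
def rSub {ι : Type*} {X U : ι → Type*} [∀ j, TopologicalSpace (X j)]
    (f : ∀ j, X j → U j → X j) (i : ι) (τ : ℕ) (Q : Set (∀ j, X j)) : ℕ∞ :=
  ⨅ (S : Set (ℕ → U i)) (_ : IsSubSpanning f i τ Q S), S.encard

/-- The numbers `(1/τ) log₂ r_inv^{(i)}(τ, Q)`. -/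
def subEntropySeq {ι : Type*} {X U : ι → Type*} [∀ j, TopologicalSpace (X j)]
    (f : ∀ j, X j → U j → X j) (i : ι) (Q : Set (∀ j, X j)) (τ : ℕ) : ℝ :=
  1 / (τ : ℝ) * Real.logb 2 ((rSub f i τ Q).toNat : ℝ)

/-- The `i`-th subsystem invariance entropy of `Q`, the limit of `subEntropySeq f i Q`. -/
def hSub {ι : Type*} {X U : ι → Type*} [∀ j, TopologicalSpace (X j)]
    (f : ∀ j, X j → U j → X j) (i : ι) (Q : Set (∀ j, X j)) : ℝ :=
  limUnder atTop (subEntropySeq f i Q)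

/-! ### Linear systems -/

/-- The linear system `x ↦ A x + B u` on `ℝ^d` with control value set `U ⊆ ℝ^m`. -/
def linSystem {d m : ℕ} (A : Matrix (Fin d) (Fin d) ℝ) (B : Matrix (Fin d) (Fin m) ℝ)
    (U : Set (Fin m → ℝ)) : (Fin d → ℝ) → U → (Fin d → ℝ) :=
  fun x u => A.mulVec x + B.mulVec (u : Fin m → ℝ)

/-- The pair `(A, B)` is controllable: the matrix `[B, A B, …, A^(d-1) B]` has rank `d`. -/
def IsControllable {d m : ℕ} (A : Matrix (Fin d) (Fin d) ℝ) (B : Matrix (Fin d) (Fin m) ℝ) :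
    Prop :=
  (Matrix.of fun (r : Fin d) (c : Fin d × Fin m) => (A ^ (c.1 : ℕ) * B) r c.2).rank = d

/-- `∑ max {0, n_z log₂ |z|}` over the distinct complex eigenvalues `z` of the real matrix `A`,
where `n_z` is the algebraic multiplicity of `z`. (A zero eigenvalue contributes `0`.) -/
def unstableSum {d : ℕ} (A : Matrix (Fin d) (Fin d) ℝ) : ℝ :=
  ∑ z ∈ (A.map (algebraMap ℝ ℂ)).charpoly.roots.toFinset,
    max 0 (((A.map (algebraMap ℝ ℂ)).charpoly.rootMultiplicity z : ℝ) * Real.logb 2 ‖z‖)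

end

end NetEntropy

/-! Both formulas are cases of one count: fix a set `I` of components and count control sequences
only through their components in `I` (`tendsto_log_spanning`). The growth rate is the sum of
`unstableSum (A j)` over `I`; `I = {i}` gives the subsystem entropy, `I = univ` the entropy of the
product.

Lower bound: if two states of `Q` are kept in `Q` by sequences that agree in component `j`, the
controls cancel and the difference of the states evolves by `A j ^ k`, so it stays bounded at time
`τ`. The set of states served by one counted sequence therefore has volume of order at most `2 ^ (-τ
* h)`, and these sets must cover `Q`.

Upper bound: divide `Q` into about `2 ^ (τ * h)` cells on which `A j ^ k`, `j ∈ I`, `k ≤ τ`,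
separates points by at most a small `ρ`. One sequence per cell, generated by a trajectory that stays
in `K`, then serves the whole cell in the components of `I`. The other components are not counted,
so their controls may depend on the initial state: controllability allows a small initial error to
be driven to zero by small corrections, and controls interior to `U j` leave room for these
(`exists_shadowing`).

Both volume estimates use a matrix `G`, a polynomial in `A`, that acts as `A` on the unstable
spectral subspace and as the identity on the complement (`exists_expansion_matrix`). It is
invertible even if `A` is not, and its determinant is exactly `2 ^ unstableSum A` in absolute value.
-/

namespace NetEntropy

/-! ### Determinants, eigenvalues and power growth of polynomials in a matrix -/

section Spectral

open Polynomial

attribute [local instance] Matrix.linftyOpNormedRing Matrix.linftyOpNormedAlgebra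

/-- A monic real polynomial factors into a part with all complex roots outside the closed unit
disc and a part with all complex roots inside. -/
theorem exists_unstable_stable_factorization (χ : ℝ[X]) (hχ : χ.Monic) :
    ∃ p q : ℝ[X], χ = p * q ∧ (∀ z : ℂ, aeval z p = 0 → 1 < ‖z‖) ∧
      ∀ z : ℂ, aeval z q = 0 → ‖z‖ ≤ 1 := by
  induction hn : χ.natDegree using Nat.strong_induction_on generalizing χ with
  | _ n ih =>
    subst hn
    by_cases h : ∀ z : ℂ, aeval z χ = 0 → ‖z‖ ≤ 1
    · exact ⟨1, χ, by simp, by simp, h⟩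
    push Not at h
    obtain ⟨z, hz, hz1⟩ := h
    -- Split off the real minimal polynomial of a root outside the disc and induct on the degree of
    -- the cofactor.
    have hint : IsIntegral ℝ z := ⟨χ, hχ, by simpa [aeval_def] using hz⟩
    obtain ⟨χ', rfl⟩ := minpoly.dvd ℝ z hz
    have hm := minpoly.monic hint
    have hχ' : χ'.Monic := hm.of_mul_monic_left hχ
    have hdeg : χ'.natDegree < (minpoly ℝ z * χ').natDegree := by
      rw [hm.natDegree_mul hχ']
      have := minpoly.natDegree_pos hint
      omega
    obtain ⟨p, q, hpq, hp, hq⟩ := ih _ hdeg χ' hχ' rfl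
    refine ⟨minpoly ℝ z * p, q, by rw [hpq, mul_assoc], fun w hw => ?_, hq⟩
    rw [map_mul, mul_eq_zero] at hw
    rcases hw with hw | hw
    -- A second root of the minimal polynomial is the image of the first under the identity or
    -- complex conjugation, so it has the same modulus.
    · have : Normal ℝ ℂ := normal_iff.2 fun x =>
        ⟨Algebra.IsIntegral.isIntegral x, IsAlgClosed.splits _⟩
      obtain ⟨σ, hσ⟩ := minpoly.exists_algEquiv_of_root (K := ℝ) (x := w) (y := z)
        hint.isAlgebraic hw
      have hnorm : ‖σ w‖ = ‖w‖ := by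
        rcases Complex.real_algHom_eq_id_or_conj (σ : ℂ →ₐ[ℝ] ℂ) with h | h
        · have := congrArg (fun g : ℂ →ₐ[ℝ] ℂ => g w) h
          simp only [AlgHom.coe_id, id] at this
          exact congrArg norm this
        · have := congrArg (fun g : ℂ →ₐ[ℝ] ℂ => g w) h
          have h2 : σ w = (starRingEnd ℂ) w := this
          rw [h2, Complex.norm_conj]
      rwa [← hnorm, hσ]
    · exact hp w hw

/-- Both sides are multiplicative in `q`, which splits over `ℂ`; for constants the identity is clear
and for linear factors it evaluates the characteristic polynomial. -/
theorem det_aeval_eq_prod_roots {d : ℕ} (M : Matrix (Fin d) (Fin d) ℂ) (q : ℂ[X]) :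
    (aeval M q).det = (M.charpoly.roots.map fun z => q.eval z).prod := by
  have hlin : ∀ r : ℂ, (aeval M (X - C r)).det
      = (M.charpoly.roots.map fun z => (X - C r).eval z).prod := by
    intro r
    have h1 : M.charpoly.eval r = (M.charpoly.roots.map fun z => r - z).prod := by
      have := (IsAlgClosed.splits M.charpoly).eval_eq_prod_roots_of_monic M.charpoly_monic r
      simpa using this
    have hcard : Multiset.card M.charpoly.roots = d := by
      rw [← (IsAlgClosed.splits M.charpoly).natDegree_eq_card_roots,
        Matrix.charpoly_natDegree_eq_dim, Fintype.card_fin]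
    have h2 : aeval M (X - C r) = -(Matrix.scalar (Fin d) r - M) := by
      simp [Matrix.algebraMap_eq_diagonal, Matrix.scalar_apply]
    rw [h2, Matrix.det_neg, ← Matrix.eval_charpoly, h1, Fintype.card_fin]
    have : (fun z => (X - C r).eval z) = fun z => (-1 : ℂ) * (r - z) := by
      funext z; simp
    rw [this, Multiset.prod_map_mul, Multiset.map_const', Multiset.prod_replicate, hcard]
  have hmul : ∀ p q : ℂ[X],
      (aeval M p).det = (M.charpoly.roots.map fun z => p.eval z).prod →
      (aeval M q).det = (M.charpoly.roots.map fun z => q.eval z).prod →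
      (aeval M (p * q)).det = (M.charpoly.roots.map fun z => (p * q).eval z).prod := by
    intro p q hp hq
    simp only [map_mul, Matrix.det_mul, hp, hq, eval_mul, Multiset.prod_map_mul]
  have hC : ∀ c : ℂ, (aeval M (C c)).det
      = (M.charpoly.roots.map fun z => (C c).eval z).prod := by
    intro c
    have hcard : Multiset.card M.charpoly.roots = d := by
      rw [← (IsAlgClosed.splits M.charpoly).natDegree_eq_card_roots,
        Matrix.charpoly_natDegree_eq_dim, Fintype.card_fin]
    simp [hcard, Matrix.algebraMap_eq_diagonal, Matrix.det_diagonal]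
  rw [(IsAlgClosed.splits q).eq_prod_roots]
  refine hmul _ _ (hC _) ?_
  induction q.roots using Multiset.induction_on with
  | empty => simp
  | cons a s ih =>
    rw [Multiset.map_cons, Multiset.prod_cons]
    exact hmul _ _ (hlin a) ih

theorem map_aeval_eq {d : ℕ} (A : Matrix (Fin d) (Fin d) ℝ) (q : ℝ[X]) :
    (aeval A q).map (algebraMap ℝ ℂ)
      = aeval (A.map (algebraMap ℝ ℂ)) (q.map (algebraMap ℝ ℂ)) := by
  rw [aeval_map_algebraMap]
  exact (aeval_algHom_apply ((Algebra.ofId ℝ ℂ).mapMatrix (m := Fin d)) A q).symm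

theorem det_aeval_real {d : ℕ} (A : Matrix (Fin d) (Fin d) ℝ) (q : ℝ[X]) :
    |(aeval A q).det|
      = ((A.map (algebraMap ℝ ℂ)).charpoly.roots.map fun z => ‖aeval z q‖).prod := by
  have h := det_aeval_eq_prod_roots (A.map (algebraMap ℝ ℂ)) (q.map (algebraMap ℝ ℂ))
  rw [← map_aeval_eq] at h
  have h2 : ((aeval A q).map (algebraMap ℝ ℂ)).det = algebraMap ℝ ℂ (aeval A q).det :=
    ((algebraMap ℝ ℂ).map_det _).symm
  rw [h2] at h
  have h3 := congrArg norm h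
  rw [Complex.coe_algebraMap, Complex.norm_real, Real.norm_eq_abs] at h3
  rw [h3]
  have h4 := map_multiset_prod (normHom : ℂ →*₀ ℝ)
    ((A.map (algebraMap ℝ ℂ)).charpoly.roots.map
      fun z => eval z (q.map (algebraMap ℝ ℂ)))
  rw [Multiset.map_map] at h4
  refine Eq.trans h4 ?_
  refine congrArg Multiset.prod (Multiset.map_congr rfl fun z _ => ?_)
  simp [eval_map_algebraMap]

/-- Spectral mapping, from the determinant formula applied to the polynomial `z - q`. -/
theorem exists_root_of_mem_roots_aeval {d : ℕ} (A : Matrix (Fin d) (Fin d) ℝ) (q : ℝ[X])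
    (z : ℂ) (hz : z ∈ ((aeval A q).map (algebraMap ℝ ℂ)).charpoly.roots) :
    ∃ w ∈ (A.map (algebraMap ℝ ℂ)).charpoly.roots, z = aeval w q := by
  have h := (mem_roots'.1 hz).2
  rw [IsRoot.def, Matrix.eval_charpoly, map_aeval_eq] at h
  have h2 : Matrix.scalar (Fin d) z - aeval (A.map (algebraMap ℝ ℂ)) (q.map (algebraMap ℝ ℂ))
      = aeval (A.map (algebraMap ℝ ℂ)) (C z - q.map (algebraMap ℝ ℂ)) := by
    simp [Matrix.algebraMap_eq_diagonal, Matrix.scalar_apply]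
  rw [h2, det_aeval_eq_prod_roots, Multiset.prod_eq_zero_iff, Multiset.mem_map] at h
  obtain ⟨w, hw, hw0⟩ := h
  refine ⟨w, hw, ?_⟩
  simpa [sub_eq_zero, eval_map_algebraMap] using hw0

theorem norm_map_ofReal {d : ℕ} (M : Matrix (Fin d) (Fin d) ℝ) :
    ‖M.map (algebraMap ℝ ℂ)‖ = ‖M‖ := by
  simp [Matrix.linfty_opNorm_def]

/-- Powers of a matrix of spectral radius at most one grow subexponentially. -/
theorem exists_norm_pow_le {d : ℕ} (M : Matrix (Fin d) (Fin d) ℝ)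
    (hM : ∀ z ∈ (M.map (algebraMap ℝ ℂ)).charpoly.roots, ‖z‖ ≤ 1) {ε : ℝ} (hε : 0 < ε) :
    ∃ C : ℝ, 0 < C ∧ ∀ k : ℕ, ‖M ^ k‖ ≤ C * (1 + ε) ^ k := by
  set a := M.map (algebraMap ℝ ℂ) with ha
  have hpow : ∀ k : ℕ, ‖a ^ k‖ = ‖M ^ k‖ := by
    intro k
    rw [← norm_map_ofReal (M ^ k), ha]
    congr 1
    exact (map_pow ((algebraMap ℝ ℂ).mapMatrix (m := Fin d)) M k).symm
  have hrad : spectralRadius ℂ a < ENNReal.ofReal (1 + ε) := by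
    refine lt_of_le_of_lt (b := 1) ?_ ?_
    · refine iSup₂_le fun z hz => ?_
      rw [Matrix.mem_spectrum_iff_isRoot_charpoly] at hz
      have := hM z ((mem_roots a.charpoly_monic.ne_zero).2 hz)
      exact_mod_cast this
    · rw [← ENNReal.ofReal_one]
      exact (ENNReal.ofReal_lt_ofReal_iff (by linarith)).2 (by linarith)
  -- Gelfand's formula bounds all large powers; the finitely many others are absorbed into the
  -- constant.
  have hev := (spectrum.pow_norm_pow_one_div_tendsto_nhds_spectralRadius a).eventually_lt_const hrad
  obtain ⟨N, hN⟩ := eventually_atTop.1 hev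
  refine ⟨1 + ∑ k ∈ Finset.range (N + 1), ‖M ^ k‖, by positivity, fun k => ?_⟩
  have hge : (1 : ℝ) ≤ (1 + ε) ^ k := one_le_pow₀ (by linarith)
  rcases Nat.lt_or_ge k (N + 1) with hk | hk
  · have h1 : ‖M ^ k‖ ≤ ∑ k ∈ Finset.range (N + 1), ‖M ^ k‖ :=
      Finset.single_le_sum (f := fun k => ‖M ^ k‖) (fun _ _ => norm_nonneg _)
        (Finset.mem_range.2 hk)
    have h2 : 0 ≤ ‖M ^ k‖ := norm_nonneg _
    nlinarith
  · have h1 := (ENNReal.ofReal_lt_ofReal_iff (by linarith)).1 (hN k (by omega))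
    have hk0 : k ≠ 0 := by omega
    have h2 : ‖a ^ k‖ ≤ (1 + ε) ^ k := by
      calc ‖a ^ k‖ = (‖a ^ k‖ ^ (1 / (k : ℝ))) ^ k := by
            rw [one_div, Real.rpow_inv_natCast_pow (norm_nonneg _) hk0]
        _ ≤ (1 + ε) ^ k := pow_le_pow_left₀ (by positivity) h1.le k
    rw [hpow] at h2
    have h3 : 0 ≤ ∑ k ∈ Finset.range (N + 1), ‖M ^ k‖ := by positivity
    nlinarith

theorem rpow_unstableSum {d : ℕ} (A : Matrix (Fin d) (Fin d) ℝ) :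
    (2 : ℝ) ^ unstableSum A
      = ((A.map (algebraMap ℝ ℂ)).charpoly.roots.map fun z => max 1 ‖z‖).prod := by
  rw [Finset.prod_multiset_map_count, unstableSum, Real.rpow_sum_of_pos (by norm_num)]
  refine Finset.prod_congr rfl fun z _ => ?_
  rw [count_roots]
  -- Since `Real.logb 2 0 = 0`, a zero eigenvalue gives the factor `1`, which is also `max 1 0`.
  rcases eq_or_ne z 0 with rfl | hz
  · simp
  have hz' : 0 < ‖z‖ := norm_pos_iff.2 hz
  rcases le_total ‖z‖ 1 with h | h
  · rw [max_eq_left h, one_pow, max_eq_left, Real.rpow_zero]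
    exact mul_nonpos_of_nonneg_of_nonpos (by positivity)
      (Real.logb_nonpos (by norm_num) hz'.le h)
  · rw [max_eq_right h, max_eq_right, mul_comm, Real.rpow_mul (by norm_num),
      Real.rpow_logb (by norm_num) (by norm_num) hz', Real.rpow_natCast]
    exact mul_nonneg (by positivity) (Real.logb_nonneg (by norm_num) h)

/-- Algebra of a splitting by complementary idempotents in a commutative ring. -/
theorem splitting_identities {R : Type*} [CommRing R] {a r P S : R} (h1 : P + S = 1)
    (h0 : P * S = 0) (hr : r * a * P = P) (k l : ℕ) :
    (a * P + S) ^ k = a ^ k * P + S ∧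
    a ^ k = (P + a * S) ^ k * S + (r * P + S) ^ l * P * (a * P + S) ^ (k + l) ∧
    (P + a * S) ^ k * S * (a * P + S) ^ (k + l) = (P + a * S) ^ k * S := by
  have hP : P * P = P := by linear_combination P * h1 - h0
  have hS : S * S = S := by linear_combination S * h1 - h0
  have key : ∀ (b c : R) (k : ℕ), (b * P + c * S) ^ k = b ^ k * P + c ^ k * S := by
    intro b c k
    induction k with
    | zero => simp [h1]
    | succ k ih =>
      rw [pow_succ, ih]
      linear_combination (b ^ k * b) * hP + (c ^ k * c) * hS + (b ^ k * c + b * c ^ k) * h0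
  have hG : ∀ k, (a * P + S) ^ k = a ^ k * P + S := fun k => by
    have := key a 1 k; simpa using this
  have hH : ∀ k, (P + a * S) ^ k = P + a ^ k * S := fun k => by
    have := key 1 a k; simpa using this
  have hR : ∀ k, (r * P + S) ^ k = r ^ k * P + S := fun k => by
    have := key r 1 k; simpa using this
  have hrl : ∀ l : ℕ, r ^ l * a ^ l * P = P := by
    intro l
    induction l with
    | zero => simp
    | succ l ih => rw [pow_succ, pow_succ]; linear_combination r * a * ih + hr
  refine ⟨hG k, ?_, ?_⟩
  · rw [hG, hH, hR, pow_add]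
    have := hrl l
    linear_combination (-a ^ k) * h1 - a ^ k * this - a ^ k * hS - h0
      - (r ^ l * a ^ k * a ^ l * (P + 1)) * hP - (a ^ k * a ^ l * P + r ^ l * P + S) * h0
  · rw [hG, hH]
    rw [pow_add]
    linear_combination (a ^ k * a ^ k * a ^ l * S - 1 + S + P * a ^ k * a ^ l) * h0 + a ^ k * S * hS

end Spectral

/-! ### The matrix that carries the unstable expansion of `A` -/

section Expansion

open Polynomial

attribute [local instance] Matrix.linftyOpNormedRing Matrix.linftyOpNormedAlgebra

/-- For every real matrix `A` there is a matrix `G` of determinant `± 2 ^ unstableSum A` whose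
iterates control, up to a subexponential factor, those of `A`. -/
theorem exists_expansion_matrix {d : ℕ} (A : Matrix (Fin d) (Fin d) ℝ) :
    ∃ G : Matrix (Fin d) (Fin d) ℝ, |G.det| = (2 : ℝ) ^ unstableSum A ∧
      (∃ C : ℝ, 0 < C ∧ ∀ (τ : ℕ) (v : Fin d → ℝ),
        ‖(G ^ τ).mulVec v‖ ≤ C * (‖v‖ + ‖(A ^ τ).mulVec v‖)) ∧
      ∀ ε : ℝ, 0 < ε → ∃ C : ℝ, 0 < C ∧ ∀ τ k : ℕ, k ≤ τ → ∀ v : Fin d → ℝ,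
        ‖(A ^ k).mulVec v‖ ≤ C * (1 + ε) ^ τ * ‖(G ^ τ).mulVec v‖ := by
  obtain ⟨p, q, hpq, hp, hq⟩ :=
    exists_unstable_stable_factorization A.charpoly A.charpoly_monic
  have hcop : IsCoprime p q := by
    rw [isCoprime_iff_aeval_ne_zero_of_isAlgClosed ℝ ℂ]
    intro z
    by_contra! h
    exact absurd (hp z h.1) (not_lt.2 (hq z h.2))
  have hcopX : IsCoprime X p := by
    rw [isCoprime_iff_aeval_ne_zero_of_isAlgClosed ℝ ℂ]
    intro z
    by_contra! h
    have h1 : z = 0 := by simpa using h.1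
    have := hp z h.2
    rw [h1, norm_zero] at this
    linarith
  obtain ⟨a, b, hab⟩ := hcop
  obtain ⟨r, s, hrs⟩ := hcopX
  -- `P` is `1` at the roots of `p` and `0` at those of `q`, and `S = 1 - P`: in `A` these are the
  -- unstable and stable spectral projections. `r` inverts `X` modulo `p`.
  set P : ℝ[X] := b * q with hP
  set S : ℝ[X] := a * p with hS
  -- `P * S` vanishes only modulo the characteristic polynomial. The quotient is commutative and, by
  -- Cayley-Hamilton, maps to matrices.
  let I : Ideal ℝ[X] := Ideal.span {A.charpoly}
  let π : ℝ[X] →+* ℝ[X] ⧸ I := Ideal.Quotient.mk I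
  let φ : ℝ[X] ⧸ I →ₐ[ℝ] Matrix (Fin d) (Fin d) ℝ :=
    Ideal.Quotient.liftₐ I (aeval A) (by
      intro f hf
      obtain ⟨g, rfl⟩ := Ideal.mem_span_singleton.1 hf
      rw [map_mul, Matrix.aeval_self_charpoly, zero_mul])
  have hφ : ∀ f : ℝ[X], φ (π f) = aeval A f := fun f => rfl
  have hχ : π A.charpoly = 0 :=
    Ideal.Quotient.eq_zero_iff_mem.2 (Ideal.mem_span_singleton_self _)
  have e1 : π P + π S = 1 := by
    rw [← map_add, hP, hS, add_comm, hab, map_one]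
  have e0 : π P * π S = 0 := by
    have : P * S = a * b * A.charpoly := by rw [hP, hS, hpq]; ring
    rw [← map_mul, this, map_mul, hχ, mul_zero]
  have er : π r * π X * π P = π P := by
    have : r * X * P = P - s * b * A.charpoly := by
      rw [hP, hpq]; linear_combination (b * q) * hrs
    rw [← map_mul, ← map_mul, this, map_sub, map_mul π (s * b), hχ, mul_zero, sub_zero]
  have key := fun k l => splitting_identities e1 e0 er k l
  -- `G` is `A` on the unstable part, `H` is `A` on the stable part, `R` is the inverse of `A` on
  -- the unstable part; each is the identity on the other part. Hence `H` and `R` have all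
  -- eigenvalues in the closed unit disc.
  set G := aeval A (X * P + S) with hG
  set H := aeval A (P + X * S) with hH
  set R := aeval A (r * P + S) with hR
  have kG : ∀ k, G ^ k = A ^ k * aeval A P + aeval A S := by
    intro k
    have := congrArg φ (key k 0).1
    simpa only [← map_mul, ← map_add, ← map_pow, hφ, aeval_X, hG] using
      this.trans (by simp only [← map_mul, ← map_add, ← map_pow, hφ]; simp)
  have kA : ∀ k l, A ^ k = H ^ k * aeval A S + R ^ l * aeval A P * G ^ (k + l) := by
    intro k l
    have := congrArg φ (key k l).2.1
    simp only [← map_mul, ← map_add, ← map_pow, hφ] at this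
    simpa only [map_mul, map_add, map_pow, aeval_X, hG, hH, hR] using this
  have kS : ∀ k l, H ^ k * aeval A S * G ^ (k + l) = H ^ k * aeval A S := by
    intro k l
    have := congrArg φ (key k l).2.2
    simp only [← map_mul, ← map_add, ← map_pow, hφ] at this
    simpa only [map_mul, map_add, map_pow, aeval_X, hG, hH, hR] using this
  have hroot : ∀ z ∈ (A.map (algebraMap ℝ ℂ)).charpoly.roots,
      (1 < ‖z‖ ∧ aeval z P = 1 ∧ aeval z S = 0 ∧ aeval z r * z = 1) ∨
      (‖z‖ ≤ 1 ∧ aeval z P = 0 ∧ aeval z S = 1) := by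
    intro z hz
    have h := (mem_roots'.1 hz).2
    rw [Matrix.charpoly_map, IsRoot.def, eval_map_algebraMap, hpq, map_mul, mul_eq_zero] at h
    have h1 : aeval z S + aeval z P = 1 := by rw [← map_add, hab, map_one]
    rcases h with h | h
    · left
      have h2 : aeval z S = 0 := by rw [hS, map_mul, h, mul_zero]
      have h3 := congrArg (aeval z) hrs
      simp only [map_add, map_mul, h, mul_zero, add_zero, map_one, aeval_X] at h3
      exact ⟨hp z h, by simpa [h2] using h1, h2, h3⟩
    · right
      have h2 : aeval z P = 0 := by rw [hP, map_mul, h, mul_zero]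
      exact ⟨hq z h, h2, by simpa [h2] using h1⟩
  refine ⟨G, ?_, ?_, ?_⟩
  · rw [hG, det_aeval_real, rpow_unstableSum]
    refine congrArg Multiset.prod (Multiset.map_congr rfl fun z hz => ?_)
    rcases hroot z hz with ⟨h1, h2, h3, -⟩ | ⟨h1, h2, h3⟩
    · simp [h2, h3, max_eq_right h1.le]
    · simp [h2, h3, max_eq_left h1]
  · refine ⟨‖aeval A P‖ + ‖aeval A S‖ + 1, by positivity, fun τ v => ?_⟩
    have hcomm : A ^ τ * aeval A P = aeval A P * A ^ τ := by
      have : A ^ τ = aeval A ((X : ℝ[X]) ^ τ) := by simp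
      rw [this, ← map_mul, ← map_mul, mul_comm]
    rw [kG, hcomm, Matrix.add_mulVec, ← Matrix.mulVec_mulVec]
    have h1 := norm_add_le ((aeval A P).mulVec ((A ^ τ).mulVec v)) ((aeval A S).mulVec v)
    have h2 := Matrix.linfty_opNorm_mulVec (aeval A P) ((A ^ τ).mulVec v)
    have h3 := Matrix.linfty_opNorm_mulVec (aeval A S) v
    have := norm_nonneg (aeval A P)
    have := norm_nonneg (aeval A S)
    have := norm_nonneg v
    have := norm_nonneg ((A ^ τ).mulVec v)
    nlinarith
  · intro ε hε
    obtain ⟨C₁, hC₁, h₁⟩ := exists_norm_pow_le H (fun z hz => by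
      obtain ⟨w, hw, rfl⟩ := exists_root_of_mem_roots_aeval A _ z hz
      rcases hroot w hw with ⟨h1, h2, h3, -⟩ | ⟨h1, h2, h3⟩
      · simp [h2, h3]
      · simpa [h2, h3] using h1) hε
    obtain ⟨C₂, hC₂, h₂⟩ := exists_norm_pow_le R (fun z hz => by
      obtain ⟨w, hw, rfl⟩ := exists_root_of_mem_roots_aeval A _ z hz
      rcases hroot w hw with ⟨h1, h2, h3, h4⟩ | ⟨h1, h2, h3⟩
      · have h5 := congrArg norm h4
        rw [norm_mul, norm_one] at h5
        simp only [map_add, map_mul, h2, h3, mul_one, add_zero]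
        have := norm_nonneg (aeval w r)
        nlinarith
      · simp [h2, h3]) hε
    refine ⟨C₁ * ‖aeval A S‖ + C₂ * ‖aeval A P‖ + 1, by positivity, fun τ k hk v => ?_⟩
    obtain ⟨l, rfl⟩ := Nat.exists_eq_add_of_le hk
    -- `G` is trivial on the stable part and `A ^ k = R ^ l * A ^ (k + l)` on the unstable one, so
    -- `G ^ (k + l)` factors out and only subexponential factors remain.
    have hA : A ^ k = (H ^ k * aeval A S + R ^ l * aeval A P) * G ^ (k + l) := by
      rw [add_mul, kS, ← kA]
    have hmono : ∀ j, j ≤ k + l → (1 + ε) ^ j ≤ (1 + ε) ^ (k + l) := fun j hj =>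
      pow_le_pow_right₀ (by linarith) hj
    rw [hA, ← Matrix.mulVec_mulVec]
    refine (Matrix.linfty_opNorm_mulVec _ _).trans ?_
    refine mul_le_mul_of_nonneg_right ?_ (norm_nonneg _)
    have t1 : ‖H ^ k * aeval A S‖ ≤ C₁ * (1 + ε) ^ (k + l) * ‖aeval A S‖ :=
      (norm_mul_le _ _).trans (mul_le_mul_of_nonneg_right ((h₁ k).trans
        (mul_le_mul_of_nonneg_left (hmono k (by omega)) hC₁.le)) (norm_nonneg _))
    have t2 : ‖R ^ l * aeval A P‖ ≤ C₂ * (1 + ε) ^ (k + l) * ‖aeval A P‖ :=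
      (norm_mul_le _ _).trans (mul_le_mul_of_nonneg_right ((h₂ l).trans
        (mul_le_mul_of_nonneg_left (hmono l (by omega)) hC₂.le)) (norm_nonneg _))
    have t3 : 0 < (1 + ε) ^ (k + l) := by positivity
    have t4 := norm_add_le (H ^ k * aeval A S) (R ^ l * aeval A P)
    linarith

end Expansion

/-! ### Volume bounds for separated sets and covers -/

section Counting

open MeasureTheory

theorem volume_mulVec_sub_lt {d : ℕ} (M : Matrix (Fin d) (Fin d) ℝ) (hM : M.det ≠ 0)
    (y : Fin d → ℝ) {s : ℝ} (hs : 0 < s) :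
    volume {v : Fin d → ℝ | ‖M.mulVec (v - y)‖ < s}
      = ENNReal.ofReal (|M.det|⁻¹ * (2 * s) ^ d) := by
  have h1 : {v : Fin d → ℝ | ‖M.mulVec (v - y)‖ < s}
      = (fun v => v - y) ⁻¹' (Matrix.toLin' M ⁻¹' Metric.ball 0 s) := by
    ext v; simp
  have hdet : LinearMap.det (Matrix.toLin' M) = M.det := LinearMap.det_toLin' M
  simp_rw [h1, sub_eq_add_neg]
  rw [measure_preimage_add_right, Measure.addHaar_preimage_linearMap _ (by rwa [hdet]),
    hdet, Real.volume_pi_ball _ hs, ← ENNReal.ofReal_mul (abs_nonneg _), abs_inv,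
    Fintype.card_fin]

/-- Provides separated sets of largest cardinality, to which no further point can be added. -/
theorem exists_maximal_finset {α : Type*} (good : Finset α → Prop) (h0 : good ∅) (N : ℕ)
    (hN : ∀ t, good t → t.card ≤ N) :
    ∃ t, good t ∧ ∀ t', good t' → t'.card ≤ t.card := by
  classical
  let T : Set ℕ := {k | ∃ t, good t ∧ t.card = k}
  have hT : T.Nonempty := ⟨0, ∅, h0, rfl⟩
  have hb : BddAbove T := ⟨N, by rintro k ⟨t, ht, rfl⟩; exact hN t ht⟩
  obtain ⟨t, ht, htc⟩ := Nat.sSup_mem hT hb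
  exact ⟨t, ht, fun t' ht' => by rw [htc]; exact le_csSup hb ⟨t', ht', rfl⟩⟩

/-- A bounded set can be divided into about `2 ^ (τ * unstableSum A)` cells on which the first
`τ` iterates of `A` do not separate points by more than `ρ`. -/
theorem exists_labelling {d : ℕ} (A : Matrix (Fin d) (Fin d) ℝ) {R ρ ε : ℝ} (hR : 0 < R)
    (hρ : 0 < ρ) (hε : 0 < ε) :
    ∃ C : ℝ, 0 < C ∧ ∀ τ : ℕ, ∃ (t : Finset (Fin d → ℝ)) (l : (Fin d → ℝ) → Fin d → ℝ),
      (∀ x, ‖x‖ ≤ R → l x ∈ t) ∧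
      (t.card : ℝ) ≤ C * ((2 : ℝ) ^ unstableSum A * (1 + ε) ^ d) ^ τ ∧
      ∀ x x', ‖x‖ ≤ R → ‖x'‖ ≤ R → l x = l x' →
        ∀ k ≤ τ, ‖(A ^ k).mulVec (x - x')‖ ≤ ρ := by
  classical
  obtain ⟨G, hG, -, hup⟩ := exists_expansion_matrix A
  obtain ⟨C, hC, hup⟩ := hup ε hε
  set D : ℝ := (2 : ℝ) ^ unstableSum A with hD
  have hDpos : 0 < D := by positivity
  refine ⟨(4 * C * (R + ρ) / ρ) ^ d, by positivity, fun τ => ?_⟩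
  set E : ℝ := (1 + ε) ^ τ with hE
  have hEpos : 0 < E := by positivity
  -- Two points within `r` of a common centre, measured after `G ^ τ`, are within `2 * r` of each
  -- other, and `C * E * (2 * r) = ρ`.
  set r : ℝ := ρ / (2 * C * E) with hr
  have hrpos : 0 < r := by positivity
  have hrC : C * E * r = ρ / 2 := by rw [hr]; field_simp
  have hdet : |(G ^ τ).det| = D ^ τ := by rw [Matrix.det_pow, abs_pow, hG]
  have hdet0 : (G ^ τ).det ≠ 0 := by
    intro h
    rw [h, abs_zero] at hdet
    exact (pow_pos hDpos τ).ne hdet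
  let good : Finset (Fin d → ℝ) → Prop := fun t =>
    (∀ y ∈ t, ‖y‖ ≤ R) ∧ ∀ y ∈ t, ∀ y' ∈ t, y ≠ y' → r ≤ ‖(G ^ τ).mulVec (y - y')‖
  have hcard : ∀ t, good t →
      (t.card : ℝ) ≤ (4 * C * (R + ρ) / ρ) ^ d * (D * (1 + ε) ^ d) ^ τ := by
    intro t ht
    -- Packing argument: cells of half radius around separated points are disjoint, have equal
    -- volume, and lie in a fixed ball by the estimate `hup` at `k = 0`.
    let cell : (Fin d → ℝ) → Set (Fin d → ℝ) := fun y => {v | ‖(G ^ τ).mulVec (v - y)‖ < r / 2}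
    have hsub : (⋃ y ∈ t, cell y) ⊆ Metric.ball 0 (R + ρ) := by
      intro v hv
      simp only [Set.mem_iUnion] at hv
      obtain ⟨y, hy, hv⟩ := hv
      have h1 := hup τ 0 (Nat.zero_le _) (v - y)
      rw [pow_zero, Matrix.one_mulVec] at h1
      have h2 : C * E * ‖(G ^ τ).mulVec (v - y)‖ ≤ C * E * r :=
        mul_le_mul_of_nonneg_left (by have : ‖(G ^ τ).mulVec (v - y)‖ < r / 2 := hv; linarith)
          (by positivity)
      have h3 := ht.1 y hy
      have h4 : ‖v‖ ≤ ‖v - y‖ + ‖y‖ := by simpa using norm_add_le (v - y) y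
      rw [mem_ball_zero_iff]
      linarith
    have hdisj : (t : Set (Fin d → ℝ)).PairwiseDisjoint cell := by
      intro y hy y' hy' hne
      refine Set.disjoint_left.2 fun v hv hv' => ?_
      have h1 := ht.2 y hy y' hy' hne
      have h2 : (G ^ τ).mulVec (y - y')
          = (G ^ τ).mulVec (v - y') - (G ^ τ).mulVec (v - y) := by
        rw [← Matrix.mulVec_sub]; congr 1; abel
      have h3 := norm_sub_le ((G ^ τ).mulVec (v - y')) ((G ^ τ).mulVec (v - y))
      have h4 : ‖(G ^ τ).mulVec (v - y)‖ < r / 2 := hv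
      have h5 : ‖(G ^ τ).mulVec (v - y')‖ < r / 2 := hv'
      rw [h2] at h1
      linarith
    have hvol : ∀ y, volume (cell y) = ENNReal.ofReal ((D ^ τ)⁻¹ * r ^ d) := by
      intro y
      rw [volume_mulVec_sub_lt _ hdet0 y (half_pos hrpos), hdet]
      congr 3; ring
    have hmeas : ∀ y ∈ t, MeasurableSet (cell y) := by
      intro y _
      have hc : Continuous fun v : Fin d → ℝ => ‖(G ^ τ).mulVec (v - y)‖ :=
        (Continuous.matrix_mulVec continuous_const (continuous_id.sub continuous_const)).norm
      exact (isOpen_lt hc continuous_const).measurableSet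
    have hle := measure_mono (μ := volume) hsub
    rw [measure_biUnion_finset hdisj hmeas, Real.volume_pi_ball _ (by positivity),
      Finset.sum_congr rfl fun y _ => hvol y, Finset.sum_const, nsmul_eq_mul,
      ← ENNReal.ofReal_natCast, ← ENNReal.ofReal_mul (by positivity),
      ENNReal.ofReal_le_ofReal_iff (by positivity), Fintype.card_fin] at hle
    have h1 : (t.card : ℝ) ≤ (2 * (R + ρ)) ^ d / ((D ^ τ)⁻¹ * r ^ d) := by
      rw [le_div_iff₀ (by positivity)]; exact hle
    refine h1.trans (le_of_eq ?_)
    have h2 : (4 * C * (R + ρ) / ρ) = 2 * (R + ρ) / (r * E) := by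
      rw [hr]; field_simp; ring
    have h3 : (D * (1 + ε) ^ d) ^ τ = D ^ τ * E ^ d := by
      rw [mul_pow, ← pow_mul, mul_comm d τ, pow_mul, ← hE]
    have h4 : (2 * (R + ρ) / (r * E)) ^ d = (2 * (R + ρ)) ^ d / (r ^ d * E ^ d) := by
      rw [div_pow, mul_pow r E d]
    rw [h2, h3, h4]
    clear_value r E
    field_simp
  obtain ⟨t, ht, hmax⟩ := exists_maximal_finset good (by simp [good])
    ⌊(4 * C * (R + ρ) / ρ) ^ d * (D * (1 + ε) ^ d) ^ τ⌋₊ (fun t ht => Nat.le_floor (hcard t ht))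
  have hcov : ∀ x, ‖x‖ ≤ R → ∃ y ∈ t, ‖(G ^ τ).mulVec (x - y)‖ < r := by
    intro x hx
    by_contra! hno
    have hxt : x ∉ t := by
      intro hxt
      have := hno x hxt
      rw [sub_self, Matrix.mulVec_zero, norm_zero] at this
      linarith
    have hgood : good (insert x t) := by
      refine ⟨fun y hy => ?_, fun y hy y' hy' hne => ?_⟩
      · rcases Finset.mem_insert.1 hy with rfl | hy
        · exact hx
        · exact ht.1 y hy
      · rcases Finset.mem_insert.1 hy with rfl | hyt <;>
          rcases Finset.mem_insert.1 hy' with rfl | hyt'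
        · exact absurd rfl hne
        · exact hno y' hyt'
        · rw [← neg_sub, Matrix.mulVec_neg, norm_neg]; exact hno y hyt
        · exact ht.2 y hyt y' hyt' hne
    have := hmax _ hgood
    rw [Finset.card_insert_of_notMem hxt] at this
    omega
  have hcov' : ∀ x : Fin d → ℝ, ∃ y, ‖x‖ ≤ R → y ∈ t ∧ ‖(G ^ τ).mulVec (x - y)‖ < r := by
    intro x
    by_cases hx : ‖x‖ ≤ R
    · obtain ⟨y, hy, h⟩ := hcov x hx
      exact ⟨y, fun _ => ⟨hy, h⟩⟩
    · exact ⟨0, fun h => absurd h hx⟩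
  choose l hl using hcov'
  refine ⟨t, l, fun x hx => (hl x hx).1, hcard t ht, fun x x' hx hx' hxx k hk => ?_⟩
  have h1 := (hl x hx).2
  have h2 := (hl x' hx').2
  rw [← hxx] at h2
  have h3 : (G ^ τ).mulVec (x - x') = (G ^ τ).mulVec (x - l x) - (G ^ τ).mulVec (x' - l x) := by
    rw [← Matrix.mulVec_sub]; congr 1; abel
  have h4 := norm_sub_le ((G ^ τ).mulVec (x - l x)) ((G ^ τ).mulVec (x' - l x))
  rw [← h3] at h4
  have h5 : C * E * ‖(G ^ τ).mulVec (x - x')‖ ≤ C * E * (2 * r) :=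
    mul_le_mul_of_nonneg_left (by linarith) (by positivity)
  have := hup τ k hk (x - x')
  linarith

/-- A cover of a set with nonempty interior by sets on which the `τ`-th iterates are uniformly
bounded has at least about `2 ^ (τ * ∑ j, unstableSum (A j))` members. -/
theorem exists_le_card_of_cover {n : ℕ} {d : Fin n → ℕ}
    (A : ∀ j, Matrix (Fin (d j)) (Fin (d j)) ℝ) (W : Set (∀ j, Fin (d j) → ℝ))
    (hW : (interior W).Nonempty) {D : ℝ} (hD : 0 < D) :
    ∃ c : ℝ, 0 < c ∧ ∀ (τ : ℕ) (ι : Type) (s : Finset ι) (V : ι → Set (∀ j, Fin (d j) → ℝ)),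
      W ⊆ ⋃ i ∈ s, V i →
      (∀ i ∈ s, ∀ x ∈ V i, ∀ x' ∈ V i, ∀ j,
        ‖x j - x' j‖ ≤ D ∧ ‖(A j ^ τ).mulVec (x j - x' j)‖ ≤ D) →
      c * ((2 : ℝ) ^ ∑ j, unstableSum (A j)) ^ τ ≤ s.card := by
  choose G hG hlow _ using fun j => exists_expansion_matrix (A j)
  choose C hC hlow using hlow
  let κ : ℝ := ∏ j, (2 * (C j * (2 * D) + 1)) ^ d j
  have hκ : 0 < κ := Finset.prod_pos fun j _ => by have := hC j; positivity
  have hWpos : 0 < volume W :=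
    (isOpen_interior.measure_pos volume hW).trans_le (measure_mono interior_subset)
  -- A finite positive lower bound `w` avoids assuming that `W` has finite volume.
  obtain ⟨w, hw, hwW⟩ := ENNReal.lt_iff_exists_nnreal_btwn.1 hWpos
  have hw' : (0 : ℝ) < w := by exact_mod_cast hw
  refine ⟨w / κ, by positivity, fun τ ι s V hcov hV => ?_⟩
  set L : ℝ := ((2 : ℝ) ^ ∑ j, unstableSum (A j)) ^ τ with hL
  have hLpos : 0 < L := by positivity
  have hdet : ∀ j, |(G j ^ τ).det| = ((2 : ℝ) ^ unstableSum (A j)) ^ τ := fun j => by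
    rw [Matrix.det_pow, abs_pow, hG]
  have hdet0 : ∀ j, (G j ^ τ).det ≠ 0 := by
    intro j h
    have := hdet j
    rw [h, abs_zero] at this
    have h2 : 0 < ((2 : ℝ) ^ unstableSum (A j)) ^ τ := by positivity
    exact h2.ne this
  have hvol : ∀ i ∈ s, volume (V i) ≤ ENNReal.ofReal (L⁻¹ * κ) := by
    intro i hi
    rcases (V i).eq_empty_or_nonempty with he | ⟨x, hx⟩
    · rw [he, measure_empty]; exact zero_le
    -- The `+ 1` turns the bound into a strict inequality.
    have hsub : V i ⊆ Set.univ.pi fun j =>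
        {v : Fin (d j) → ℝ | ‖(G j ^ τ).mulVec (v - x j)‖ < C j * (2 * D) + 1} := by
      intro x' hx' j _
      obtain ⟨h1, h2⟩ := hV i hi x' hx' x hx j
      have h3 := hlow j τ (x' j - x j)
      have h4 : C j * (‖x' j - x j‖ + ‖(A j ^ τ).mulVec (x' j - x j)‖) ≤ C j * (2 * D) :=
        mul_le_mul_of_nonneg_left (by linarith) (hC j).le
      show ‖(G j ^ τ).mulVec (x' j - x j)‖ < C j * (2 * D) + 1
      linarith
    refine (measure_mono hsub).trans (le_of_eq ?_)
    rw [volume_pi_pi, Finset.prod_congr rfl fun j _ =>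
      volume_mulVec_sub_lt (G j ^ τ) (hdet0 j) (x j)
        (s := C j * (2 * D) + 1) (by have := hC j; positivity),
      ← ENNReal.ofReal_prod_of_nonneg (fun j _ => by have := hC j; positivity),
      Finset.prod_mul_distrib, Finset.prod_inv_distrib, Finset.prod_congr rfl fun j _ => hdet j,
      Finset.prod_pow, ← Real.rpow_sum_of_pos (by norm_num)]
  have h1 : ENNReal.ofReal w ≤ ENNReal.ofReal (s.card * (L⁻¹ * κ)) := by
    rw [ENNReal.ofReal_coe_nnreal]
    calc (w : ENNReal) ≤ volume W := hwW.le
      _ ≤ volume (⋃ i ∈ s, V i) := measure_mono hcov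
      _ ≤ ∑ i ∈ s, volume (V i) := measure_biUnion_finset_le _ _
      _ ≤ ∑ _i ∈ s, ENNReal.ofReal (L⁻¹ * κ) := Finset.sum_le_sum hvol
      _ = ENNReal.ofReal (s.card * (L⁻¹ * κ)) := by
        rw [Finset.sum_const, nsmul_eq_mul, ENNReal.ofReal_mul (p := (s.card : ℝ)) (by positivity),
          ENNReal.ofReal_natCast]
  rw [ENNReal.ofReal_le_ofReal_iff (by positivity)] at h1
  have h2 : (s.card : ℝ) * (L⁻¹ * κ) = s.card * κ / L := by field_simp
  rw [h2, le_div_iff₀ hLpos] at h1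
  rw [div_mul_eq_mul_div, div_le_iff₀ hκ]
  exact h1

end Counting

/-! ### Correcting the components outside `I` -/

section Steering

/-- A controllable pair can be steered to the origin in `d` steps, where it stays, with controls
and states bounded linearly by the initial state. -/
theorem IsControllable.exists_deadbeat {d m : ℕ} {A : Matrix (Fin d) (Fin d) ℝ}
    {B : Matrix (Fin d) (Fin m) ℝ} (h : IsControllable A B) :
    ∃ c : ℝ, 0 ≤ c ∧ ∀ v : Fin d → ℝ, ∃ (w : ℕ → Fin m → ℝ) (e : ℕ → Fin d → ℝ),
      e 0 = v ∧ (∀ k, e (k + 1) = A.mulVec (e k) + B.mulVec (w k)) ∧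
      ∀ k, ‖w k‖ ≤ c * ‖v‖ ∧ ‖e k‖ ≤ c * ‖v‖ := by
  set M : Matrix (Fin d) (Fin d × Fin m) ℝ :=
    Matrix.of fun r c => (A ^ (c.1 : ℕ) * B) r c.2 with hM
  have hrange : LinearMap.range M.mulVecLin = ⊤ := by
    refine Submodule.eq_top_of_finrank_eq ?_
    rw [Module.finrank_fin_fun]
    exact h
  obtain ⟨R, hR⟩ := LinearMap.exists_rightInverse_of_surjective M.mulVecLin hrange
  -- The blocks of a preimage of `-A ^ d v` under the controllability matrix. Block `c` is
  -- multiplied by `A ^ c`, so it is applied at time `d - 1 - c`.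
  let g : ℕ → (Fin d → ℝ) →ₗ[ℝ] (Fin m → ℝ) := fun c =>
    if hc : c < d then
      (LinearMap.funLeft ℝ ℝ fun a : Fin m => ((⟨c, hc⟩ : Fin d), a)) ∘ₗ R ∘ₗ
        (-(A ^ d).mulVecLin)
    else 0
  let w : ℕ → (Fin d → ℝ) →ₗ[ℝ] (Fin m → ℝ) := fun k => if k < d then g (d - 1 - k) else 0
  let e : ℕ → (Fin d → ℝ) →ₗ[ℝ] (Fin d → ℝ) := fun k =>
    Nat.rec LinearMap.id (fun k E => Matrix.toLin' A ∘ₗ E + Matrix.toLin' B ∘ₗ w k) k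
  have he0 : ∀ v, e 0 v = v := fun v => rfl
  have hes : ∀ k v, e (k + 1) v = A.mulVec (e k v) + B.mulVec (w k v) := fun k v => rfl
  have hform : ∀ k v, e k v = (A ^ k).mulVec v
      + ∑ i ∈ Finset.range k, (A ^ (k - 1 - i)).mulVec (B.mulVec (w i v)) := by
    intro k v
    induction k with
    | zero => simp [he0]
    | succ k ih =>
      rw [hes, ih, Finset.sum_range_succ, Matrix.mulVec_add, Matrix.mulVec_mulVec, ← pow_succ',
        Matrix.mulVec_sum]
      have h1 : ∀ i ∈ Finset.range k, A.mulVec ((A ^ (k - 1 - i)).mulVec (B.mulVec (w i v)))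
          = (A ^ (k + 1 - 1 - i)).mulVec (B.mulVec (w i v)) := by
        intro i hi
        have hi := Finset.mem_range.1 hi
        rw [Matrix.mulVec_mulVec, ← pow_succ']
        congr 2; omega
      rw [Finset.sum_congr rfl h1]
      simp [add_assoc]
  have hed : ∀ v, e d v = 0 := by
    intro v
    have h1 : ∑ i ∈ Finset.range d, (A ^ (d - 1 - i)).mulVec (B.mulVec (w i v))
        = ∑ i ∈ Finset.range d, (A ^ i).mulVec (B.mulVec (g i v)) := by
      rw [← Finset.sum_range_reflect (fun i => (A ^ i).mulVec (B.mulVec (g i v)))]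
      refine Finset.sum_congr rfl fun i hi => ?_
      simp only [w, if_pos (Finset.mem_range.1 hi)]
    have h2 : ∑ i ∈ Finset.range d, (A ^ i).mulVec (B.mulVec (g i v))
        = M.mulVec (R (-((A ^ d).mulVec v))) := by
      rw [Finset.sum_range]
      funext r
      rw [Finset.sum_apply, Matrix.mulVec, dotProduct, Fintype.sum_prod_type]
      refine Finset.sum_congr rfl fun c _ => ?_
      rw [Matrix.mulVec_mulVec, Matrix.mulVec, dotProduct]
      refine Finset.sum_congr rfl fun a _ => ?_
      simp [hM, g, LinearMap.funLeft]
    have h3 : M.mulVec (R (-((A ^ d).mulVec v))) = -((A ^ d).mulVec v) :=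
      LinearMap.congr_fun hR _
    rw [hform, h1, h2, h3, add_neg_cancel]
  have hw : ∀ k, d ≤ k → ∀ v, w k v = 0 := by
    intro k hk v
    simp [w, not_lt.2 hk]
  have he : ∀ k, d ≤ k → ∀ v, e k v = 0 := by
    intro k hk v
    induction k, hk using Nat.le_induction with
    | base => exact hed v
    | succ k hk ih => rw [hes, ih, hw k hk, Matrix.mulVec_zero, Matrix.mulVec_zero, add_zero]
  -- Controls and states depend linearly on `v` and vanish from time `d` on, so finitely many
  -- operator norms suffice.
  let c : ℝ := ∑ k ∈ Finset.range d,
    (‖LinearMap.toContinuousLinearMap (w k)‖ + ‖LinearMap.toContinuousLinearMap (e k)‖)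
  have hc : 0 ≤ c := Finset.sum_nonneg fun _ _ => by positivity
  refine ⟨c, hc, fun v => ⟨fun k => w k v, fun k => e k v, he0 v, fun k => hes k v, fun k => ?_⟩⟩
  rcases Nat.lt_or_ge k d with hk | hk
  · have h1 : ‖LinearMap.toContinuousLinearMap (w k)‖ + ‖LinearMap.toContinuousLinearMap (e k)‖
        ≤ c := Finset.single_le_sum (f := fun k => ‖LinearMap.toContinuousLinearMap (w k)‖
          + ‖LinearMap.toContinuousLinearMap (e k)‖) (fun _ _ => by positivity)
          (Finset.mem_range.2 hk)
    have h2 := (LinearMap.toContinuousLinearMap (w k)).le_opNorm v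
    have h3 := (LinearMap.toContinuousLinearMap (e k)).le_opNorm v
    have h4 := norm_nonneg (LinearMap.toContinuousLinearMap (w k))
    have h5 := norm_nonneg (LinearMap.toContinuousLinearMap (e k))
    exact ⟨h2.trans (mul_le_mul_of_nonneg_right (by linarith) (norm_nonneg _)),
      h3.trans (mul_le_mul_of_nonneg_right (by linarith) (norm_nonneg _))⟩
  · simp only [hw k hk, he k hk, norm_zero]
    have := mul_nonneg hc (norm_nonneg v)
    exact ⟨this, this⟩

variable {n : ℕ} {d m : Fin n → ℕ} {A : ∀ j, Matrix (Fin (d j)) (Fin (d j)) ℝ}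
  {B : ∀ j, Matrix (Fin (d j)) (Fin (m j)) ℝ} {U : ∀ j, Set (Fin (m j) → ℝ)}

/-- Finitely many controls, interior in the coordinates outside `I`, suffice to steer a compact
set into an open set. -/
theorem exists_finite_controls {Q O : Set (∀ j, Fin (d j) → ℝ)} (hQ : IsCompact Q)
    (hne : Q.Nonempty)
    (hO : IsOpen O)
    (hsteer : ∀ x ∈ Q, ∃ u : ∀ j, U j, prodSystem (fun j => linSystem (A j) (B j) (U j)) x u ∈ O)
    (I : Set (Fin n)) (hU : ∀ j ∉ I, U j ⊆ closure (interior (U j))) :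
    ∃ (F : (∀ j, Fin (d j) → ℝ) → ∀ j, U j) (δ : ℝ), 0 < δ ∧
      (∀ x ∈ Q, prodSystem (fun j => linSystem (A j) (B j) (U j)) x (F x) ∈ O) ∧
      ∀ x ∈ Q, ∀ j ∉ I, Metric.ball (F x j : Fin (m j) → ℝ) δ ⊆ U j := by
  classical
  let T : Type := {u : ∀ j, U j // ∀ j ∉ I, (u j : Fin (m j) → ℝ) ∈ interior (U j)}
  let V : T → Set (∀ j, Fin (d j) → ℝ) := fun u =>
    {x | prodSystem (fun j => linSystem (A j) (B j) (U j)) x u.1 ∈ O}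
  have hVo : ∀ u, IsOpen (V u) := by
    intro u
    refine hO.preimage ?_
    refine continuous_pi fun j => ?_
    refine Continuous.add (Continuous.matrix_mulVec continuous_const ?_) continuous_const
    exact continuous_apply j
  have hcov : Q ⊆ ⋃ u, V u := by
    intro x hx
    obtain ⟨u, hu⟩ := hsteer x hx
    let Y : Set (∀ j, Fin (m j) → ℝ) :=
      {y | (fun j => (A j).mulVec (x j) + (B j).mulVec (y j)) ∈ O}
    have hY : IsOpen Y := by
      refine hO.preimage (continuous_pi fun j => ?_)
      refine continuous_const.add (Continuous.matrix_mulVec continuous_const ?_)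
      exact continuous_apply j
    -- Only components outside `I` are perturbed into the interior of `U j`; those in `I` stay
    -- fixed, as nothing is assumed of them.
    let S : ∀ j, Set (Fin (m j) → ℝ) := fun j =>
      if j ∈ I then {(u j : Fin (m j) → ℝ)} else interior (U j)
    have hmem : (fun j => (u j : Fin (m j) → ℝ)) ∈ closure (Set.univ.pi S) := by
      rw [closure_pi_set]
      intro j _
      by_cases hj : j ∈ I
      · simp [S, hj]
      · simp only [S, if_neg hj]
        exact hU j hj (u j).2
    obtain ⟨y, hyY, hyS⟩ := mem_closure_iff.1 hmem Y hY hu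
    have hy1 : ∀ j, y j ∈ U j := by
      intro j
      have := hyS j trivial
      by_cases hj : j ∈ I
      · simp only [S, if_pos hj, Set.mem_singleton_iff] at this
        rw [this]; exact (u j).2
      · simp only [S, if_neg hj] at this
        exact interior_subset this
    refine Set.mem_iUnion.2 ⟨⟨fun j => ⟨y j, hy1 j⟩, fun j hj => ?_⟩, hyY⟩
    have := hyS j trivial
    simpa only [S, if_neg hj] using this
  obtain ⟨t, ht⟩ := hQ.elim_finite_subcover V hVo hcov
  -- Finiteness of the subcover makes the margin `δ` uniform on `Q`.
  have hδ : ∀ᶠ δ : ℝ in 𝓝[>] 0, ∀ u ∈ t, ∀ j, j ∉ I →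
      Metric.ball (u.1 j : Fin (m j) → ℝ) δ ⊆ U j := by
    refine (Filter.eventually_all_finset t).2 fun u _ => Filter.eventually_all.2 fun j => ?_
    by_cases hj : j ∈ I
    · exact Filter.Eventually.of_forall fun _ h => absurd hj h
    obtain ⟨δ₀, hδ₀, hball⟩ := Metric.mem_nhds_iff.1 (mem_interior_iff_mem_nhds.1 (u.2 j hj))
    filter_upwards [Ioo_mem_nhdsGT hδ₀] with δ hδ _
    exact (Metric.ball_subset_ball hδ.2.le).trans hball
  obtain ⟨δ, hδt, hδpos⟩ := (hδ.and self_mem_nhdsWithin).exists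
  have hex : ∀ x, ∃ u : ∀ j, U j, x ∈ Q →
      prodSystem (fun j => linSystem (A j) (B j) (U j)) x u ∈ O ∧
      ∀ j ∉ I, Metric.ball (u j : Fin (m j) → ℝ) δ ⊆ U j := by
    intro x
    by_cases hx : x ∈ Q
    · obtain ⟨u, hu, hxu⟩ := Set.mem_iUnion₂.1 (ht hx)
      exact ⟨u.1, fun _ => ⟨hxu, hδt u hu⟩⟩
    · obtain ⟨x₀, hx₀⟩ := hne
      obtain ⟨u, -⟩ := hsteer x₀ hx₀
      exact ⟨u, fun h => absurd h hx⟩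
  choose F hF using hex
  exact ⟨F, δ, hδpos, fun x hx => (hF x hx).1, fun x hx => (hF x hx).2⟩

/-- Every point of `Q` has a control sequence which keeps nearby points in the interior of `Q`, up
to a change of the control components outside `I`. -/
theorem exists_shadowing {Q K : Set (∀ j, Fin (d j) → ℝ)} (hQ : IsCompact Q)
    (hne : Q.Nonempty)
    (hK : IsCompact K) (hKQ : K ⊆ interior Q)
    (hsteer : ∀ x ∈ Q, ∃ u : ∀ j, U j,
      prodSystem (fun j => linSystem (A j) (B j) (U j)) x u ∈ interior K)
    (I : Set (Fin n)) (hAB : ∀ j ∉ I, IsControllable (A j) (B j))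
    (hU : ∀ j ∉ I, U j ⊆ closure (interior (U j))) :
    ∃ ρ : ℝ, 0 < ρ ∧ ∀ x ∈ Q, ∃ ω : ℕ → ∀ j, U j, ∀ (τ : ℕ) (x' : ∀ j, Fin (d j) → ℝ),
      (∀ j ∈ I, ∀ k ≤ τ, ‖(A j ^ k).mulVec (x' j - x j)‖ ≤ ρ) →
      (∀ j ∉ I, ‖x' j - x j‖ ≤ ρ) →
      ∃ ω' : ℕ → ∀ j, U j, (∀ j ∈ I, ∀ k, ω' k j = ω k j) ∧ ∀ k, 1 ≤ k → k ≤ τ →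
        transition (prodSystem fun j => linSystem (A j) (B j) (U j)) k x' ω' ∈ interior Q := by
  set f := prodSystem fun j => linSystem (A j) (B j) (U j) with hf
  obtain ⟨F, δ, hδ, hF, hball⟩ := exists_finite_controls hQ hne isOpen_interior hsteer I hU
  obtain ⟨η, hη, hthick⟩ := hK.exists_thickening_subset_open isOpen_interior hKQ
  have hdb : ∀ j, ∃ c : ℝ, 0 ≤ c ∧ (j ∉ I → ∀ v : Fin (d j) → ℝ,
      ∃ (w : ℕ → Fin (m j) → ℝ) (e : ℕ → Fin (d j) → ℝ),
        e 0 = v ∧ (∀ k, e (k + 1) = (A j).mulVec (e k) + (B j).mulVec (w k)) ∧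
        ∀ k, ‖w k‖ ≤ c * ‖v‖ ∧ ‖e k‖ ≤ c * ‖v‖) := by
    intro j
    by_cases hj : j ∈ I
    · exact ⟨0, le_rfl, fun h => absurd hj h⟩
    · obtain ⟨c, hc, h⟩ := (hAB j hj).exists_deadbeat
      exact ⟨c, hc, fun _ => h⟩
  choose c hc hdb using hdb
  have hsum : 0 ≤ ∑ j, c j := Finset.sum_nonneg fun j _ => hc j
  set μ : ℝ := min η δ with hμ
  have hμpos : 0 < μ := lt_min hη hδ
  -- Ensures `ρ < μ` and `c j * ρ < μ` for every `j`: state errors stay below the distance `η`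
  -- available around `K`, control corrections below the margin `δ`.
  set ρ : ℝ := μ / (2 * (1 + ∑ j, c j)) with hρ
  have hρpos : 0 < ρ := by positivity
  have hρeq : ρ + (∑ j, c j) * ρ = μ / 2 := by rw [hρ]; field_simp
  have hρμ : ρ < μ := by have := mul_nonneg hsum hρpos.le; linarith
  have hcρ : ∀ j, c j * ρ < μ := by
    intro j
    have h1 : c j ≤ ∑ j, c j := Finset.single_le_sum (fun j _ => hc j) (Finset.mem_univ j)
    have := mul_le_mul_of_nonneg_right h1 hρpos.le
    linarith
  refine ⟨ρ, hρpos, fun x hx => ?_⟩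
  let y : ℕ → ∀ j, Fin (d j) → ℝ := fun k => (fun z => f z (F z))^[k] x
  have hys : ∀ k, y (k + 1) = f (y k) (F (y k)) := fun k => Function.iterate_succ_apply' _ _ _
  have hyQ : ∀ k, y k ∈ Q := by
    intro k
    induction k with
    | zero => exact hx
    | succ k ih => rw [hys]; exact interior_subset (hKQ (interior_subset (hF _ ih)))
  refine ⟨fun k => F (y k), fun τ x' hxI hxI' => ?_⟩
  -- In `I` the control is unchanged and the error evolves freely, small by hypothesis; outside `I`
  -- the deadbeat correction is added.
  have hcorr : ∀ j, ∃ (w : ℕ → Fin (m j) → ℝ) (e : ℕ → Fin (d j) → ℝ),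
      e 0 = x' j - x j ∧ (∀ k, e (k + 1) = (A j).mulVec (e k) + (B j).mulVec (w k)) ∧
      (∀ k ≤ τ, ‖e k‖ < η) ∧ (∀ k, ‖w k‖ < δ) ∧ (j ∈ I → ∀ k, w k = 0) := by
    intro j
    by_cases hj : j ∈ I
    · refine ⟨fun _ => 0, fun k => (A j ^ k).mulVec (x' j - x j), by simp, fun k => ?_,
        fun k hk => (hxI j hj k hk).trans_lt (hρμ.trans_le (min_le_left _ _)), fun _ => by simpa,
        fun _ _ => rfl⟩
      rw [Matrix.mulVec_mulVec, ← pow_succ', Matrix.mulVec_zero, add_zero]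
    · obtain ⟨w, e, h0, hs, hb⟩ := hdb j hj (x' j - x j)
      have hle : c j * ‖x' j - x j‖ < μ :=
        (mul_le_mul_of_nonneg_left (hxI' j hj) (hc j)).trans_lt (hcρ j)
      exact ⟨w, e, h0, hs, fun k _ => (hb k).2.trans_lt (hle.trans_le (min_le_left _ _)),
        fun k => (hb k).1.trans_lt (hle.trans_le (min_le_right _ _)), fun h => absurd h hj⟩
  choose w e he0 hes hesmall hwsmall hwI using hcorr
  have hctl : ∀ k j, ∃ v : U j, (v : Fin (m j) → ℝ) = F (y k) j + w j k := by
    intro k j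
    by_cases hj : j ∈ I
    · exact ⟨F (y k) j, by rw [hwI j hj, add_zero]⟩
    · refine ⟨⟨F (y k) j + w j k, hball _ (hyQ k) j hj ?_⟩, rfl⟩
      rw [mem_ball_iff_norm, add_sub_cancel_left]
      exact hwsmall j k
  choose ω' hω' using hctl
  have htraj : ∀ k j, transition f k x' ω' j = y k j + e j k := by
    intro k
    induction k with
    | zero => intro j; rw [he0]; simp [transition, y]
    | succ k ih =>
      intro j
      have h1 : transition f (k + 1) x' ω' j
          = (A j).mulVec (transition f k x' ω' j) + (B j).mulVec (ω' k j : Fin (m j) → ℝ) := rfl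
      have h2 : y (k + 1) j = (A j).mulVec (y k j) + (B j).mulVec (F (y k) j : Fin (m j) → ℝ) := by
        rw [hys]; rfl
      rw [h1, ih, hω', h2, hes, Matrix.mulVec_add, Matrix.mulVec_add]
      abel
  refine ⟨ω', fun j hj k => Subtype.ext (by rw [hω', hwI j hj, add_zero]), fun k hk1 hk => ?_⟩
  obtain ⟨l, rfl⟩ := Nat.exists_eq_add_of_le' hk1
  refine hthick (Metric.mem_thickening_iff.2 ⟨y (l + 1), ?_, ?_⟩)
  · rw [hys]; exact interior_subset (hF _ (hyQ l))
  · rw [dist_pi_lt_iff hη]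
    intro j
    rw [htraj, dist_eq_norm, add_sub_cancel_left]
    exact hesmall j _ hk

end Steering

/-! ### From counting to growth rates -/

section Entropy

/-- An infimum in `ℕ∞` over a nonempty family is attained, so a lower bound for finite members
suffices and `toNat` loses nothing. -/
theorem iInf_encard_bounds {α : Type*} (P : Set α → Prop) {c C : ℝ}
    (hlow : ∀ S, P S → S.Finite → c ≤ S.ncard)
    (hup : ∃ S, P S ∧ S.Finite ∧ (S.ncard : ℝ) ≤ C) :
    (⨅ (S : Set α) (_ : P S), S.encard) ≠ ⊤ ∧
      c ≤ ((⨅ (S : Set α) (_ : P S), S.encard).toNat : ℝ) ∧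
      ((⨅ (S : Set α) (_ : P S), S.encard).toNat : ℝ) ≤ C := by
  obtain ⟨S₀, hP₀, hfin₀, hC⟩ := hup
  have hle : (⨅ (S : Set α) (_ : P S), S.encard) ≤ S₀.encard := iInf₂_le S₀ hP₀
  have htop : (⨅ (S : Set α) (_ : P S), S.encard) ≠ ⊤ :=
    ne_top_of_le_ne_top hfin₀.encard_lt_top.ne hle
  have : Nonempty {S // P S} := ⟨⟨S₀, hP₀⟩⟩
  obtain ⟨⟨S, hS⟩, hSeq⟩ := ciInf_mem fun S : {S // P S} => S.1.encard
  have hSeq' : S.encard = ⨅ (S : Set α) (_ : P S), S.encard := by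
    rw [iInf_subtype'] ; exact hSeq
  have hSfin : S.Finite := by
    rw [← Set.encard_ne_top_iff, hSeq']; exact htop
  refine ⟨htop, ?_, ?_⟩
  · rw [← hSeq']; exact hlow S hS hSfin
  · have h1 : (⨅ (S : Set α) (_ : P S), S.encard).toNat ≤ S₀.ncard :=
      ENat.toNat_le_toNat hle hfin₀.encard_lt_top.ne
    exact (Nat.cast_le.2 h1).trans hC

/-- After taking logarithms and dividing by `τ` the constants disappear, so `C` may depend on the
loss `η`. -/
theorem tendsto_of_exponential_bounds {r : ℕ → ℕ} {h c : ℝ} (hc : 0 < c)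
    (hlow : ∀ τ, c * ((2 : ℝ) ^ h) ^ τ ≤ r τ)
    (hup : ∀ η : ℝ, 0 < η → ∃ C : ℝ, 0 < C ∧ ∀ τ, (r τ : ℝ) ≤ C * ((2 : ℝ) ^ (h + η)) ^ τ) :
    Tendsto (fun τ : ℕ => 1 / (τ : ℝ) * Real.logb 2 (r τ)) atTop (𝓝 h) := by
  have hlog : ∀ (c g : ℝ) (τ : ℕ), 0 < c → 0 < τ →
      1 / (τ : ℝ) * Real.logb 2 (c * ((2 : ℝ) ^ g) ^ τ) = Real.logb 2 c / τ + g := by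
    intro c g τ hc hτ
    have : (0 : ℝ) < τ := by exact_mod_cast hτ
    rw [Real.logb_mul hc.ne' (by positivity), Real.logb_pow,
      Real.logb_rpow (by norm_num) (by norm_num)]
    field_simp
  have hlim : ∀ c g : ℝ, Tendsto (fun τ : ℕ => Real.logb 2 c / (τ : ℝ) + g) atTop (𝓝 g) := by
    intro c g
    simpa using (tendsto_const_div_atTop_nhds_zero_nat (Real.logb 2 c)).add_const g
  refine tendsto_order.2 ⟨fun a ha => ?_, fun a ha => ?_⟩
  · filter_upwards [(hlim c h).eventually_const_lt ha, eventually_gt_atTop 0] with τ hτ hτ0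
    refine hτ.trans_le ?_
    rw [← hlog c h τ hc hτ0]
    exact mul_le_mul_of_nonneg_left
      (Real.logb_le_logb_of_le (by norm_num) (by positivity) (hlow τ)) (by positivity)
  · obtain ⟨C, hC, hCr⟩ := hup ((a - h) / 2) (by linarith)
    filter_upwards [(hlim C (h + (a - h) / 2)).eventually_lt_const (u := a) (by linarith),
      eventually_gt_atTop 0] with τ hτ hτ0
    refine lt_of_le_of_lt ?_ hτ
    rw [← hlog C _ τ hC hτ0]
    have hr : (0 : ℝ) < r τ := lt_of_lt_of_le (by positivity) (hlow τ)
    exact mul_le_mul_of_nonneg_left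
      (Real.logb_le_logb_of_le (by norm_num) hr (hCr τ)) (by positivity)

variable {n : ℕ} {d m : Fin n → ℕ} {A : ∀ j, Matrix (Fin (d j)) (Fin (d j)) ℝ}
  {B : ∀ j, Matrix (Fin (d j)) (Fin (m j)) ℝ} {U : ∀ j, Set (Fin (m j) → ℝ)}

/-- The labelling of `exists_labelling` for a product of linear maps. -/
theorem exists_product_labelling (A : ∀ j, Matrix (Fin (d j)) (Fin (d j)) ℝ) {R ρ η : ℝ}
    (hR : 0 < R) (hρ : 0 < ρ) (hη : 0 < η) :
    ∃ C : ℝ, 0 < C ∧ ∀ τ : ℕ, ∃ (t : Finset (∀ j, Fin (d j) → ℝ))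
      (l : (∀ j, Fin (d j) → ℝ) → ∀ j, Fin (d j) → ℝ),
      (∀ x, (∀ j, ‖x j‖ ≤ R) → l x ∈ t) ∧
      (t.card : ℝ) ≤ C * ((2 : ℝ) ^ (∑ j, unstableSum (A j) + η)) ^ τ ∧
      ∀ x x', (∀ j, ‖x j‖ ≤ R) → (∀ j, ‖x' j‖ ≤ R) → l x = l x' →
        ∀ j, ∀ k ≤ τ, ‖(A j ^ k).mulVec (x j - x' j)‖ ≤ ρ := by
  classical
  -- The losses `(1 + ε) ^ d j` of all components together must stay below `2 ^ η`.
  obtain ⟨ε, hεη, hε⟩ : ∃ ε : ℝ, (1 + ε) ^ (∑ j, d j) < (2 : ℝ) ^ η ∧ 0 < ε := by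
    have h1 : Tendsto (fun ε : ℝ => (1 + ε) ^ (∑ j, d j)) (𝓝[>] 0) (𝓝 1) := by
      have : Continuous fun ε : ℝ => (1 + ε) ^ (∑ j, d j) := by fun_prop
      have h2 := this.tendsto 0
      simp only [add_zero, one_pow] at h2
      exact h2.mono_left nhdsWithin_le_nhds
    exact ((h1.eventually_lt_const (Real.one_lt_rpow (by norm_num) hη)).and
      self_mem_nhdsWithin).exists
  choose C hC t l hl hcard hsep using fun j => exists_labelling (A j) hR hρ hε
  refine ⟨∏ j, C j, Finset.prod_pos fun j _ => hC j, fun τ =>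
    ⟨Fintype.piFinset fun j => t j τ, fun x j => l j τ (x j),
      fun x hx => Fintype.mem_piFinset.2 fun j => hl j τ _ (hx j), ?_,
      fun x x' hx hx' h j k hk => hsep j τ _ _ (hx j) (hx' j) (congrFun h j) k hk⟩⟩
  rw [Fintype.card_piFinset, Nat.cast_prod]
  calc ∏ j, ((t j τ).card : ℝ)
      ≤ ∏ j, C j * ((2 : ℝ) ^ unstableSum (A j) * (1 + ε) ^ d j) ^ τ :=
        Finset.prod_le_prod (fun _ _ => by positivity) fun j _ => hcard j τ
    _ = (∏ j, C j) * ((2 : ℝ) ^ (∑ j, unstableSum (A j)) * (1 + ε) ^ (∑ j, d j)) ^ τ := by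
        rw [Finset.prod_mul_distrib, Finset.prod_pow, Finset.prod_mul_distrib,
          Finset.prod_pow_eq_pow_sum, Real.rpow_sum_of_pos (by norm_num)]
    _ ≤ (∏ j, C j) * ((2 : ℝ) ^ (∑ j, unstableSum (A j) + η)) ^ τ := by
        rw [Real.rpow_add (by norm_num)]
        have := Finset.prod_nonneg fun j (_ : j ∈ Finset.univ) => (hC j).le
        gcongr

theorem transition_sub_transition {x x' : ∀ j, Fin (d j) → ℝ} {ω ω' : ℕ → ∀ j, U j} {j : Fin n}
    (h : ∀ k, ω k j = ω' k j) (k : ℕ) :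
    transition (prodSystem fun j => linSystem (A j) (B j) (U j)) k x ω j
      - transition (prodSystem fun j => linSystem (A j) (B j) (U j)) k x' ω' j
      = (A j ^ k).mulVec (x j - x' j) := by
  induction k with
  | zero => simp [transition]
  | succ k ih =>
    rw [pow_succ', ← Matrix.mulVec_mulVec, ← ih, Matrix.mulVec_sub]
    simp only [transition, prodSystem, linSystem, h k, add_sub_add_right_eq_sub]

theorem unstableSum_zero {d : ℕ} : unstableSum (0 : Matrix (Fin d) (Fin d) ℝ) = 0 := by
  refine Finset.sum_eq_zero fun z hz => ?_
  have h : (0 : Matrix (Fin d) (Fin d) ℝ).map (algebraMap ℝ ℂ) = 0 := by ext; simp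
  rw [h, Matrix.charpoly_zero] at hz
  have hz0 : z = 0 ∧ d ≠ 0 := by
    simpa using (Polynomial.mem_roots'.1 (Multiset.mem_toFinset.1 hz)).2
  simp [hz0.1]

/-- The exponential growth rate of the number of control sequences needed, when only the
components in `I` of the control sequences, as recorded by `res`, are counted. -/
theorem tendsto_log_spanning {Q K : Set (∀ j, Fin (d j) → ℝ)}
    (hQ : IsCompact Q) (hQi : (interior Q).Nonempty)
    (hK : IsCompact K) (hKQ : K ⊆ interior Q)
    (hsteer : ∀ x ∈ Q, ∃ u : ∀ j, U j,
      prodSystem (fun j => linSystem (A j) (B j) (U j)) x u ∈ interior K)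
    (I : Finset (Fin n)) (hAB : ∀ j ∉ I, IsControllable (A j) (B j))
    (hU : ∀ j ∉ I, U j ⊆ closure (interior (U j))) {β : Type} (res : (ℕ → ∀ j, U j) → β)
    (hres : ∀ ω ω', res ω = res ω' ↔ ∀ j ∈ I, ∀ k, ω k j = ω' k j) {r : ℕ → ℕ∞}
    (hr : ∀ τ, r τ = ⨅ (S : Set β) (_ : IsSpanning
      (prodSystem fun j => linSystem (A j) (B j) (U j)) τ Q {ω | res ω ∈ S}), S.encard) :
    (∀ τ, r τ ≠ ⊤) ∧
      Tendsto (fun τ : ℕ => 1 / (τ : ℝ) * Real.logb 2 ((r τ).toNat : ℝ)) atTop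
        (𝓝 (∑ j ∈ I, unstableSum (A j))) := by
  classical
  set f := prodSystem fun j => linSystem (A j) (B j) (U j) with hf
  -- Uncounted components get the zero matrix: no contribution to the rate, while `0 ^ 0 = 1` still
  -- records the distance of the initial states.
  let A' : ∀ j, Matrix (Fin (d j)) (Fin (d j)) ℝ := fun j => if j ∈ I then A j else 0
  have hA' : ∑ j ∈ I, unstableSum (A j) = ∑ j, unstableSum (A' j) := by
    rw [← Finset.sum_subset (Finset.subset_univ I)]
    · exact Finset.sum_congr rfl fun j hj => by simp only [A', if_pos hj]
    · intro j _ hj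
      simp only [A', if_neg hj, unstableSum_zero]
  rw [hA']
  obtain ⟨R, hR, hQR⟩ : ∃ R : ℝ, 0 < R ∧ ∀ x ∈ Q, ∀ j, ‖x j‖ ≤ R := by
    obtain ⟨R, hR, h⟩ := hQ.isBounded.exists_pos_norm_le
    exact ⟨R, hR, fun x hx j => (norm_le_pi_norm x j).trans (h x hx)⟩
  obtain ⟨c, hc, hcount⟩ := exists_le_card_of_cover A' Q hQi (D := 2 * R) (by positivity)
  have hlow : ∀ τ, ∀ S : Set β, IsSpanning f τ Q {ω | res ω ∈ S} → S.Finite →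
      c * ((2 : ℝ) ^ ∑ j, unstableSum (A' j)) ^ τ ≤ S.ncard := by
    intro τ S hS hfin
    -- The states of `Q` served by the counted data `b`; two of them may use sequences that differ
    -- outside `I`.
    let V : β → Set (∀ j, Fin (d j) → ℝ) := fun b =>
      {x | x ∈ Q ∧ ∃ ω, res ω = b ∧ ∀ k, 1 ≤ k → k ≤ τ → transition f k x ω ∈ interior Q}
    rw [Set.ncard_eq_toFinset_card S hfin]
    refine hcount τ β hfin.toFinset V (fun x hx => ?_) ?_
    · obtain ⟨ω, hω, h⟩ := hS x hx
      exact Set.mem_iUnion₂.2 ⟨res ω, hfin.mem_toFinset.2 hω, hx, ω, rfl, h⟩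
    · rintro b - x ⟨hx, ω, hω, h⟩ x' ⟨hx', ω', hω', h'⟩ j
      have hd : ∀ z ∈ Q, ∀ z' ∈ Q, ‖z j - z' j‖ ≤ 2 * R := fun z hz z' hz' =>
        (norm_sub_le _ _).trans (by linarith [hQR z hz j, hQR z' hz' j])
      refine ⟨hd x hx x' hx', ?_⟩
      rcases Nat.eq_zero_or_pos τ with rfl | hτ
      · simpa using hd x hx x' hx'
      by_cases hj : j ∈ I
      · simp only [A', if_pos hj]
        rw [← transition_sub_transition ((hres ω ω').1 (hω.trans hω'.symm) j hj)]
        exact hd _ (interior_subset (h τ hτ le_rfl)) _ (interior_subset (h' τ hτ le_rfl))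
      · simp only [A', if_neg hj, zero_pow hτ.ne', Matrix.zero_mulVec, norm_zero]
        positivity
  obtain ⟨ρ, hρ, hshadow⟩ := exists_shadowing hQ (hQi.mono interior_subset) hK hKQ hsteer
    (I : Set (Fin n)) (fun j hj => hAB j (by simpa using hj)) (fun j hj => hU j (by simpa using hj))
  have hup : ∀ η : ℝ, 0 < η → ∃ C : ℝ, 0 < C ∧ ∀ τ, ∃ S : Set β,
      IsSpanning f τ Q {ω | res ω ∈ S} ∧ S.Finite ∧
      (S.ncard : ℝ) ≤ C * ((2 : ℝ) ^ (∑ j, unstableSum (A' j) + η)) ^ τ := by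
    intro η hη
    obtain ⟨C, hC, hlab⟩ := exists_product_labelling A' hR hρ hη
    refine ⟨C, hC, fun τ => ?_⟩
    obtain ⟨t, l, hlt, hcard, hsep⟩ := hlab τ
    -- One representative and its shadowing sequence for each label that occurs on `Q`, arbitrary
    -- values for the others.
    have hrep : ∀ b, ∃ (x : ∀ j, Fin (d j) → ℝ) (ω : ℕ → ∀ j, U j), (∃ y ∈ Q, l y = b) →
        x ∈ Q ∧ l x = b ∧ ∀ (τ : ℕ) (x' : ∀ j, Fin (d j) → ℝ),
        (∀ j ∈ (I : Set (Fin n)), ∀ k ≤ τ, ‖(A j ^ k).mulVec (x' j - x j)‖ ≤ ρ) →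
        (∀ j ∉ (I : Set (Fin n)), ‖x' j - x j‖ ≤ ρ) →
        ∃ ω' : ℕ → ∀ j, U j, (∀ j ∈ (I : Set (Fin n)), ∀ k, ω' k j = ω k j) ∧
          ∀ k, 1 ≤ k → k ≤ τ → transition f k x' ω' ∈ interior Q := by
      intro b
      by_cases hb : ∃ y ∈ Q, l y = b
      · obtain ⟨y, hy, hyb⟩ := hb
        obtain ⟨ω, hω⟩ := hshadow y hy
        exact ⟨y, ω, fun _ => ⟨hy, hyb, hω⟩⟩
      · obtain ⟨x, hx⟩ := hQi.mono interior_subset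
        obtain ⟨ω, -⟩ := hshadow x hx
        exact ⟨x, ω, fun h => absurd h hb⟩
    choose y ω hy using hrep
    refine ⟨((t.image fun b => res (ω b) : Finset β) : Set β), fun x hx => ?_,
      Finset.finite_toSet _, ?_⟩
    · obtain ⟨hyQ, hly, hω⟩ := hy (l x) ⟨x, hx, rfl⟩
      have hclose := hsep x (y (l x)) (hQR x hx) (hQR _ hyQ) hly.symm
      obtain ⟨ω', hω', htr⟩ := hω τ x
        (fun j hj k hk => by
          have := hclose j k hk
          simpa only [A', if_pos (Finset.mem_coe.1 hj)] using this)
        -- At `k = 0` the power is the identity, also for the zero matrix.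
        (fun j _ => by simpa using hclose j 0 (Nat.zero_le _))
      refine ⟨ω', ?_, htr⟩
      have heq : res ω' = res (ω (l x)) := (hres _ _).2 fun j hj k => hω' j hj k
      rw [Set.mem_ofPred_eq, heq]
      exact Finset.mem_coe.2 (Finset.mem_image_of_mem _ (hlt x (hQR x hx)))
    · rw [Set.ncard_coe_finset]
      exact (Nat.cast_le.2 Finset.card_image_le).trans hcard
  refine ⟨fun τ => ?_, tendsto_of_exponential_bounds hc (fun τ => ?_) fun η hη => ?_⟩
  · obtain ⟨C, -, h⟩ := hup 1 one_pos
    rw [hr]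
    exact (iInf_encard_bounds _ (hlow τ) (h τ)).1
  · obtain ⟨C, -, h⟩ := hup 1 one_pos
    rw [hr]
    exact (iInf_encard_bounds _ (hlow τ) (h τ)).2.1
  · obtain ⟨C, hC, h⟩ := hup η hη
    refine ⟨C, hC, fun τ => ?_⟩
    rw [hr]
    exact (iInf_encard_bounds _ (hlow τ) (h τ)).2.2

end Entropy

end NetEntropy

/-! ### The entropy formula and additivity -/

theorem theorem2 {n : ℕ} (d m : Fin n → ℕ)
    (A : ∀ j, Matrix (Fin (d j)) (Fin (d j)) ℝ)
    (B : ∀ j, Matrix (Fin (d j)) (Fin (m j)) ℝ)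
    (U : ∀ j, Set (Fin (m j) → ℝ))
    (f : ∀ j, (Fin (d j) → ℝ) → U j → (Fin (d j) → ℝ))
    (hf : ∀ j, f j = NetEntropy.linSystem (A j) (B j) (U j))
    (Q : Set (∀ j, Fin (d j) → ℝ))
    (hQ : NetEntropy.IsControlledInvariant (NetEntropy.prodSystem f) Q)
    (K : Set (∀ j, Fin (d j) → ℝ)) (hK : IsCompact K) (hKQ : K ⊆ interior Q)
    (hsteer : ∀ x ∈ Q, ∃ u : ∀ j, U j, NetEntropy.prodSystem f x u ∈ interior K) :
    (∀ i : Fin n,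
      (∀ j, j ≠ i → NetEntropy.IsControllable (A j) (B j)) →
      (∀ j, j ≠ i → U j ⊆ closure (interior (U j))) →
        (∀ τ : ℕ, 0 < τ → NetEntropy.rSub f i τ Q ≠ ⊤) ∧
        Tendsto (NetEntropy.subEntropySeq f i Q) atTop (𝓝 (NetEntropy.hSub f i Q)) ∧
        NetEntropy.hSub f i Q = NetEntropy.unstableSum (A i)) ∧
    ((∀ j, NetEntropy.IsControllable (A j) (B j)) →
      (∀ i j : Fin n, j ≠ i → U j ⊆ closure (interior (U j))) →
        (∀ τ : ℕ, 0 < τ → NetEntropy.rInv (NetEntropy.prodSystem f) τ Q ≠ ⊤) ∧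
        Tendsto (NetEntropy.entropySeq (NetEntropy.prodSystem f) Q) atTop
          (𝓝 (NetEntropy.hInv (NetEntropy.prodSystem f) Q)) ∧
        ∑ i, NetEntropy.hSub f i Q = NetEntropy.hInv (NetEntropy.prodSystem f) Q) := by
  obtain rfl : f = fun j => NetEntropy.linSystem (A j) (B j) (U j) := funext hf
  have hsub : ∀ i : Fin n,
      (∀ j, j ≠ i → NetEntropy.IsControllable (A j) (B j)) →
      (∀ j, j ≠ i → U j ⊆ closure (interior (U j))) →
        (∀ τ : ℕ, 0 < τ → NetEntropy.rSub
          (fun j => NetEntropy.linSystem (A j) (B j) (U j)) i τ Q ≠ ⊤) ∧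
        Tendsto (NetEntropy.subEntropySeq
          (fun j => NetEntropy.linSystem (A j) (B j) (U j)) i Q) atTop
          (𝓝 (NetEntropy.unstableSum (A i))) := by
    intro i hAB hU
    -- Case `I = {i}`: only the `i`-th control component is recorded.
    obtain ⟨h1, h2⟩ := NetEntropy.tendsto_log_spanning hQ.isCompact hQ.interior_nonempty hK hKQ
      hsteer {i} (fun j hj => hAB j (by simpa using hj)) (fun j hj => hU j (by simpa using hj))
      (fun ω k => ω k i) (fun ω ω' => by simp [funext_iff])
      (r := fun τ => NetEntropy.rSub (fun j => NetEntropy.linSystem (A j) (B j) (U j)) i τ Q)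
      (fun τ => rfl)
    rw [Finset.sum_singleton] at h2
    exact ⟨fun τ _ => h1 τ, h2⟩
  refine ⟨fun i hAB hU => ?_, fun hAB hU => ?_⟩
  · obtain ⟨h1, h2⟩ := hsub i hAB hU
    have h3 : NetEntropy.hSub (fun j => NetEntropy.linSystem (A j) (B j) (U j)) i Q
        = NetEntropy.unstableSum (A i) := h2.limUnder_eq
    exact ⟨h1, by rwa [h3], h3⟩
  -- Case `I = univ`: everything is recorded, and the conditions outside `I` are void.
  · obtain ⟨h1, h2⟩ := NetEntropy.tendsto_log_spanning hQ.isCompact hQ.interior_nonempty hK hKQ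
      hsteer Finset.univ (fun j hj => absurd (Finset.mem_univ j) hj)
      (fun j hj => absurd (Finset.mem_univ j) hj) id
      (fun ω ω' => by simp only [id, funext_iff, Finset.mem_univ, true_imp_iff]; exact forall_comm)
      (r := fun τ => NetEntropy.rInv (NetEntropy.prodSystem
        fun j => NetEntropy.linSystem (A j) (B j) (U j)) τ Q) (fun τ => rfl)
    have h3 : NetEntropy.hInv (NetEntropy.prodSystem
        fun j => NetEntropy.linSystem (A j) (B j) (U j)) Q
        = ∑ i, NetEntropy.unstableSum (A i) := h2.limUnder_eq
    refine ⟨fun τ _ => h1 τ, by rw [h3]; exact h2, ?_⟩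
    rw [h3]
    exact Finset.sum_congr rfl fun i _ => (hsub i (fun j _ => hAB j) (hU i)).2.limUnder_eq
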